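/- Let $\mathcal A$ be a finite alphabet with $|\mathcal A|>1$, let $S=(S_{a,b})_{a,b\in\mathcal A}$ be a matrix of $0$'s and $1$'s without zero rows or zero columns, and let $\Omega_S=\{\omega\in\mathcal A^{\mathbb N}: S_{\omega_j,\omega_{j+1}}=1\text{ for all }j\ge 0\}$, with the topology and $\sigma$-algebra inherited from $\mathcal A^{\mathbb N}$ and the metric $d(\omega,\gamma)=2^{-\min\{j\ge 0:\,\omega_j\neq\gamma_j\}}$ for $\omega\ne\gamma$. Let $T:\Omega_S\to\Omega_S$, $(T\omega)_j=\omega_{j+1}$, be the left shift, and assume that $T$ is topologically mixing: for all nonempty open $U,V\subset\Omega_S$ there is $N$ with $U\cap T^{-n}V\neq\emptyset$ for all $n\ge N$. Let $\phi:\Omega_S\to\mathbb R$ be Hölder continuous with respect to $d$, and let $\mathbb P$ be the Gibbs measure of $\phi$, with pressure $P\in\mathbb R$, i.e. a $T$-invariant Borel probability measure on $\Omega_S$ for which there are constants $c_1,c_2>0$ such that, for all $\omega\in\Omega_S$ and $n\ge 0$, $$c_1\le\frac{\mathbb P[\omega_0,\dots,\omega_{n-1}]}{\exp\bigl(-Pn+\sum_{j=0}^{n-1}\phi(T^j\omega)\bigr)}\le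 c_2,$$ where $[\omega_0,\dots,\omega_{n-1}]=\{\gamma\in\Omega_S:\gamma_j=\omega_j\text{ for }0\le j<n\}$. Let $\mathbb P\circ T$ be the measure on $\Omega_S$ given by $\mathbb P\circ T(E)=\sum_{a\in\mathcal A}\mathbb P(T(E\cap[a]))$ for measurable $E\subset\Omega_S$, where $[a]=\{\omega\in\Omega_S:\omega_0=a\}$; then $\mathbb P\ll\mathbb P\circ T$, and we let $J=\frac{d\mathbb P}{d\mathbb P\circ T}$ be the inverse Jacobian of $\mathbb P$. Then there exists a continuous function $h:\Omega_S\to\mathbb R$ with $h>0$ such that $$J(\omega)=e^{\phi(\omega)-P}\,\frac{h(\omega)}{h(T\omega)}\qquad\text{for }\mathbb P\circ T\text{-almost every }\omega\in\Omega_S.$$ -/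

import Mathlib

open MeasureTheory

namespace MarkovGibbs

/-- A transition matrix: a matrix of `0`s and `1`s over the alphabet `𝒜` with no row and no column
that vanishes identically. -/
structure IsTransitionMatrix {𝒜 : Type*} (S : Matrix 𝒜 𝒜 ℕ) : Prop where
  zero_or_one : ∀ a b, S a b = 0 ∨ S a b = 1
  row_ne_zero : ∀ a, ∃ b, S a b ≠ 0
  col_ne_zero : ∀ b, ∃ a, S a b ≠ 0

/-- The one-sided topological Markov shift `Ω_S` of the sequences `ω : ℕ → 𝒜` all of whose
transitions are allowed by `S`. Being a subtype, it carries the topology and the `σ`-algebra induced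
by the product topology and the product `σ`-algebra of `ℕ → 𝒜`. -/
abbrev MarkovShift {𝒜 : Type*} (S : Matrix 𝒜 𝒜 ℕ) : Type _ :=
  {ω : ℕ → 𝒜 // ∀ j, S (ω j) (ω (j + 1)) = 1}

/-- The left shift `T : Ω_S → Ω_S`, `(T ω)_j = ω_{j+1}`. -/
def shift {𝒜 : Type*} (S : Matrix 𝒜 𝒜 ℕ) (ω : MarkovShift S) : MarkovShift S :=
  ⟨fun j => ω.1 (j + 1), fun j => ω.2 (j + 1)⟩

/-- The `n`-cylinder `[ω_0, …, ω_{n-1}]` of `Ω_S`. -/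
def cyl {𝒜 : Type*} {S : Matrix 𝒜 𝒜 ℕ} (ω : MarkovShift S) (n : ℕ) : Set (MarkovShift S) :=
  {γ | ∀ j < n, γ.1 j = ω.1 j}

/-- The `1`-cylinder `[a]` of `Ω_S`. -/
def letterCyl {𝒜 : Type*} (S : Matrix 𝒜 𝒜 ℕ) (a : 𝒜) : Set (MarkovShift S) :=
  {ω | ω.1 0 = a}

/-- `T` is topologically mixing: for all nonempty open `U`, `V` the set `U ∩ T⁻ⁿ V` is nonempty for
all sufficiently large `n`. -/
def IsTopologicallyMixing {X : Type*} [TopologicalSpace X] (T : X → X) : Prop :=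
  ∀ U V : Set X, IsOpen U → IsOpen V → U.Nonempty → V.Nonempty →
    ∃ N : ℕ, ∀ n ≥ N, (U ∩ T^[n] ⁻¹' V).Nonempty

open scoped Classical in
/-- The metric `d(ω, γ) = 2^{-m}` for `ω ≠ γ`, where `m = min {j | ω_j ≠ γ_j}`, and
`d(ω, ω) = 0`. -/
noncomputable def seqDist {𝒜 : Type*} {S : Matrix 𝒜 𝒜 ℕ} (ω γ : MarkovShift S) : ℝ :=
  if ω = γ then 0 else (2 ^ sInf {j : ℕ | ω.1 j ≠ γ.1 j})⁻¹

/-- Hölder continuity (with some positive exponent) with respect to the metric `seqDist`. -/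
def IsHolder {𝒜 : Type*} {S : Matrix 𝒜 𝒜 ℕ} (φ : MarkovShift S → ℝ) : Prop :=
  ∃ C α : ℝ, 0 < α ∧ ∀ ω γ, |φ ω - φ γ| ≤ C * seqDist ω γ ^ α

/-- `μ` is a Gibbs measure of the potential `φ`, with pressure `P`: a `T`-invariant Borel probability
measure on `Ω_S` such that
`c₁ ≤ μ[ω_0, …, ω_{n-1}] / exp(-P n + ∑_{j<n} φ(T^j ω)) ≤ c₂` for all `ω ∈ Ω_S` and `n ≥ 0`, for
some constants `c₁, c₂ > 0`. -/
structure IsGibbsMeasure {𝒜 : Type*} [MeasurableSpace 𝒜] {S : Matrix 𝒜 𝒜 ℕ}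
    (φ : MarkovShift S → ℝ) (P : ℝ) (μ : Measure (MarkovShift S)) : Prop where
  isProbabilityMeasure : IsProbabilityMeasure μ
  invariant : MeasurePreserving (shift S) μ μ
  bounds : ∃ c₁ c₂ : ℝ, 0 < c₁ ∧ 0 < c₂ ∧ ∀ (ω : MarkovShift S) (n : ℕ),
    c₁ ≤ μ.real (cyl ω n) / Real.exp (-P * n + birkhoffSum (shift S) φ n ω) ∧
    μ.real (cyl ω n) / Real.exp (-P * n + birkhoffSum (shift S) φ n ω) ≤ c₂

theorem iUnion_letterCyl {𝒜 : Type*} (S : Matrix 𝒜 𝒜 ℕ) : ⋃ a, letterCyl S a = Set.univ := by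
  ext ω; simp [letterCyl]

theorem injOn_shift {𝒜 : Type*} (S : Matrix 𝒜 𝒜 ℕ) (a : 𝒜) :
    Set.InjOn (shift S) (letterCyl S a) := by
  intro ω hω γ hγ h
  apply Subtype.ext
  funext j
  cases j with
  | zero => exact (show ω.1 0 = a from hω).trans (show γ.1 0 = a from hγ).symm
  | succ j => exact congrFun (congrArg Subtype.val h) j

section CompShift

variable {𝒜 : Type*} [MeasurableSpace 𝒜] [MeasurableSingletonClass 𝒜] [Countable 𝒜]

/-- `T` maps measurable subsets of `[a]` to measurable sets. -/
theorem measurableSet_image_shift (S : Matrix 𝒜 𝒜 ℕ) (a : 𝒜) {E : Set (MarkovShift S)}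
    (hE : MeasurableSet E) : MeasurableSet (shift S '' (E ∩ letterCyl S a)) := by
  obtain ⟨F, hF, rfl⟩ := hE
  have hc : Measurable fun ω : ℕ → 𝒜 => (fun j => Nat.casesOn j a ω : ℕ → 𝒜) := by
    refine measurable_pi_lambda _ fun j => ?_
    cases j with
    | zero => exact measurable_const
    | succ j => exact measurable_pi_apply j
  have hb : MeasurableSet {ω : MarkovShift S | S a (ω.1 0) = 1} := by
    have h0 : Measurable fun ω : MarkovShift S => ω.1 0 :=
      (measurable_pi_apply 0).comp measurable_subtype_coe
    exact h0 (Set.to_countable {b | S a b = 1}).measurableSet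
  have key : shift S '' (Subtype.val ⁻¹' F ∩ letterCyl S a) =
      ((fun ω : MarkovShift S => (fun j => Nat.casesOn j a ω.1 : ℕ → 𝒜)) ⁻¹' F) ∩
        {ω : MarkovShift S | S a (ω.1 0) = 1} := by
    ext γ
    constructor
    · rintro ⟨ω, ⟨hωF, hωa⟩, rfl⟩
      have ha : ω.1 0 = a := hωa
      have he : (fun j => Nat.casesOn j a (shift S ω).1 : ℕ → 𝒜) = ω.1 := by
        funext j
        cases j with
        | zero => exact ha.symm
        | succ j => rfl
      refine ⟨?_, ?_⟩
      · change (fun j => Nat.casesOn j a (shift S ω).1 : ℕ → 𝒜) ∈ F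
        rw [he]; exact hωF
      · change S a (ω.1 1) = 1
        rw [← ha]; exact ω.2 0
    · rintro ⟨hγF, hγ⟩
      let ω : ℕ → 𝒜 := fun j => Nat.casesOn j a γ.1
      have hω : ∀ j, S (ω j) (ω (j + 1)) = 1 := by
        intro j
        cases j with
        | zero => exact hγ
        | succ j => exact γ.2 j
      exact ⟨⟨ω, hω⟩, ⟨hγF, rfl⟩, rfl⟩
  rw [key]
  exact (hc.comp measurable_subtype_coe hF).inter hb

/-- The measure `μ ∘ T` on `Ω_S`: `(μ ∘ T)(E) = ∑_a μ(T(E ∩ [a]))` for measurable `E`. -/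
noncomputable def compShift {S : Matrix 𝒜 𝒜 ℕ} (μ : Measure (MarkovShift S)) :
    Measure (MarkovShift S) :=
  Measure.ofMeasurable (fun E _ => ∑' a, μ (shift S '' (E ∩ letterCyl S a))) (by simp) (by
    intro E hE hd
    rw [ENNReal.tsum_comm]
    refine tsum_congr fun a => ?_
    rw [Set.iUnion_inter, Set.image_iUnion, measure_iUnion]
    · intro i j hij
      exact (((hd hij).mono Set.inter_subset_left Set.inter_subset_left).image
        (injOn_shift S a) Set.inter_subset_right Set.inter_subset_right)
    · exact fun i => measurableSet_image_shift S a (hE i))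

theorem compShift_apply {S : Matrix 𝒜 𝒜 ℕ} (μ : Measure (MarkovShift S))
    {E : Set (MarkovShift S)} (hE : MeasurableSet E) :
    compShift μ E = ∑' a, μ (shift S '' (E ∩ letterCyl S a)) :=
  Measure.ofMeasurable_apply E hE

/-- The inverse Jacobian `J = dμ / d(μ ∘ T)` of `μ`, as a real function. -/
noncomputable def inverseJacobian {S : Matrix 𝒜 𝒜 ℕ} (μ : Measure (MarkovShift S))
    (ω : MarkovShift S) : ℝ :=
  (μ.rnDeriv (compShift μ) ω).toReal

theorem le_compShift {S : Matrix 𝒜 𝒜 ℕ} {μ : Measure (MarkovShift S)}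
    (hμ : MeasurePreserving (shift S) μ μ) : μ ≤ compShift μ := by
  refine Measure.le_iff.2 fun E hE => ?_
  rw [compShift_apply μ hE]
  calc μ E = μ (⋃ a, E ∩ letterCyl S a) := by
        rw [← Set.inter_iUnion, iUnion_letterCyl, Set.inter_univ]
    _ ≤ ∑' a, μ (E ∩ letterCyl S a) := measure_iUnion_le _
    _ ≤ ∑' a, μ (shift S '' (E ∩ letterCyl S a)) := by
        refine ENNReal.tsum_le_tsum fun a => ?_
        rw [← hμ.measure_preimage (measurableSet_image_shift S a hE).nullMeasurableSet]
        exact measure_mono (Set.subset_preimage_image _ _)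

/-- For an invariant probability measure over a finite alphabet the inverse Jacobian is the density
of `μ` with respect to `μ ∘ T`, so that its definition involves no default value. -/
theorem withDensity_inverseJacobian [Finite 𝒜] {S : Matrix 𝒜 𝒜 ℕ} {μ : Measure (MarkovShift S)}
    [IsProbabilityMeasure μ] (hμ : MeasurePreserving (shift S) μ μ) :
    (compShift μ).withDensity (fun ω => ENNReal.ofReal (inverseJacobian μ ω)) = μ := by
  have : Fintype 𝒜 := Fintype.ofFinite 𝒜
  have hfin : IsFiniteMeasure (compShift μ) := by
    refine ⟨?_⟩
    rw [compShift_apply μ MeasurableSet.univ, tsum_fintype]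
    exact ENNReal.sum_lt_top.2 fun a _ => measure_lt_top _ _
  have hac : μ ≪ compShift μ := Measure.absolutelyContinuous_of_le (le_compShift hμ)
  calc _ = (compShift μ).withDensity (μ.rnDeriv (compShift μ)) := by
        refine withDensity_congr_ae ?_
        filter_upwards [Measure.rnDeriv_lt_top μ (compShift μ)] with ω hω
        exact ENNReal.ofReal_toReal hω.ne
    _ = μ := Measure.withDensity_rnDeriv_eq _ _ hac

end CompShift

end MarkovGibbs

namespace MarkovGibbs

variable {𝒜 : Type*} {S : Matrix 𝒜 𝒜 ℕ}

/-! ### Cylinders and inverse branches of the shift -/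

/-! Put `ψ = φ - P`. The function `h` is a fixed point of the transfer operator of `ψ`, obtained by
compactness. Invariance of `μ` makes `GibbsBand` stable under `transfer` (`transfer_mem_gibbsBand`),
and its members are bounded above and away from zero (`gibbsBand_bounds`). `DistortionCone` is
stable as well, and carries the regularity that makes `h` continuous. The intersection of the two
sets is convex, closed under pointwise limits and contains `1`, so `exists_transfer_eq_self`
applies.

Then `γ = ψ + log h - log (h ∘ T)` is normalised, so `ρ = e^γ d(μ ∘ T)` is a probability measure,
and it remains to show `ρ = μ`. This is an entropy argument (`withDensity_exp_eq`). On words of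
length `n + 1`, `∫ log (ρ / μ) dμ` is, up to an error `ε n → 0`, at least the one-step decrease of
`b n = ∫ log μ[ω_0, …, ω_{n-1}] dμ - n ∫ γ dμ`, and the upper Gibbs bound keeps `b` bounded above.
Testing `gibbs_variational` on a cylinder, a discrepancy between `ρ` and `μ` would force `b` to grow
linearly. Hence the measures agree on cylinders, and `e^γ` is the inverse Jacobian. -/

open scoped Classical in
/-- The inverse branch `ω ↦ a ω` of the shift, extended by the identity to those `ω` for which the
transition from `a` to `ω_0` is forbidden. -/
noncomputable def prepend (S : Matrix 𝒜 𝒜 ℕ) (a : 𝒜) (ω : MarkovShift S) : MarkovShift S :=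
  if h : S a (ω.1 0) = 1 then
    ⟨fun j => Nat.casesOn j a ω.1, fun j => by
      cases j with
      | zero => exact h
      | succ j => exact ω.2 j⟩
  else ω

theorem prepend_zero {a : 𝒜} {ω : MarkovShift S} (h : S a (ω.1 0) = 1) :
    (prepend S a ω).1 0 = a := by
  simp [prepend, h]

theorem prepend_succ {a : 𝒜} {ω : MarkovShift S} (h : S a (ω.1 0) = 1) (j : ℕ) :
    (prepend S a ω).1 (j + 1) = ω.1 j := by
  simp [prepend, h]

theorem shift_prepend {a : 𝒜} {ω : MarkovShift S} (h : S a (ω.1 0) = 1) :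
    shift S (prepend S a ω) = ω :=
  Subtype.ext (funext fun j => prepend_succ h j)

theorem prepend_shift (ω : MarkovShift S) : prepend S (ω.1 0) (shift S ω) = ω := by
  have h : S (ω.1 0) ((shift S ω).1 0) = 1 := ω.2 0
  refine Subtype.ext (funext fun j => ?_)
  cases j with
  | zero => exact prepend_zero h
  | succ j => exact prepend_succ h j

theorem cyl_eq_of_mem {ω γ : MarkovShift S} {n : ℕ} (h : γ ∈ cyl ω n) : cyl γ n = cyl ω n := by
  ext x
  exact ⟨fun hx j hj => (hx j hj).trans (h j hj), fun hx j hj => (hx j hj).trans (h j hj).symm⟩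

theorem mem_cyl_comm {ω γ : MarkovShift S} {n : ℕ} : γ ∈ cyl ω n ↔ ω ∈ cyl γ n :=
  ⟨fun h j hj => (h j hj).symm, fun h j hj => (h j hj).symm⟩

theorem cyl_anti (ω : MarkovShift S) {m n : ℕ} (h : m ≤ n) : cyl ω n ⊆ cyl ω m :=
  fun _ hγ j hj => hγ j (hj.trans_le h)

theorem shift_mem_cyl {ω γ : MarkovShift S} {n : ℕ} (h : γ ∈ cyl ω (n + 1)) :
    shift S γ ∈ cyl (shift S ω) n :=
  fun j hj => h (j + 1) (by omega)

theorem prepend_mem_cyl {a : 𝒜} {ω γ : MarkovShift S} {n : ℕ} (hω : S a (ω.1 0) = 1)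
    (hγ : S a (γ.1 0) = 1) (h : γ ∈ cyl ω n) : prepend S a γ ∈ cyl (prepend S a ω) (n + 1) := by
  intro j hj
  cases j with
  | zero => rw [prepend_zero hω, prepend_zero hγ]
  | succ j => rw [prepend_succ hω, prepend_succ hγ]; exact h j (by omega)

/-- The condition `1 ≤ n` fixes the first letter of the image, which decides whether `ω_0` may be
put back in front. -/
theorem shift_image_cyl_succ (ω : MarkovShift S) {n : ℕ} (hn : 1 ≤ n) :
    shift S '' cyl ω (n + 1) = cyl (shift S ω) n := by
  refine Set.Subset.antisymm (Set.image_subset_iff.2 fun γ hγ => shift_mem_cyl hγ) fun γ hγ => ?_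
  have hω : S (ω.1 0) ((shift S ω).1 0) = 1 := ω.2 0
  have h : S (ω.1 0) (γ.1 0) = 1 := by rw [hγ 0 (by omega)]; exact hω
  refine ⟨prepend S (ω.1 0) γ, ?_, shift_prepend h⟩
  have := prepend_mem_cyl hω h hγ
  rwa [prepend_shift] at this

theorem shift_preimage_cyl [Fintype 𝒜] (ω : MarkovShift S) {n : ℕ} (hn : 1 ≤ n) :
    shift S ⁻¹' cyl ω n =
      ⋃ a ∈ Finset.univ.filter fun a => S a (ω.1 0) = 1, cyl (prepend S a ω) (n + 1) := by
  ext γ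
  simp only [Finset.mem_filter, Finset.mem_univ, true_and, Set.mem_iUnion, exists_prop]
  constructor
  · intro hγ
    have h0 : (shift S γ).1 0 = ω.1 0 := hγ 0 (by omega)
    have h : S (γ.1 0) (ω.1 0) = 1 := by rw [← h0]; exact γ.2 0
    refine ⟨γ.1 0, h, ?_⟩
    have := prepend_mem_cyl h (γ.2 0) hγ
    rwa [prepend_shift] at this
  · rintro ⟨a, ha, hγ⟩
    have := shift_mem_cyl hγ
    rwa [shift_prepend ha] at this

section Measurability

variable [MeasurableSpace 𝒜]

theorem measurable_coord (j : ℕ) :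
    Measurable fun ω : MarkovShift S => ω.1 j :=
  (measurable_pi_apply j).comp measurable_subtype_coe

variable [MeasurableSingletonClass 𝒜]

theorem measurableSet_cyl (ω : MarkovShift S) (n : ℕ) : MeasurableSet (cyl ω n) := by
  have : cyl ω n = ⋂ j, ⋂ _ : j < n, (fun γ : MarkovShift S => γ.1 j) ⁻¹' {ω.1 j} := by
    ext γ; simp [cyl]
  rw [this]
  exact MeasurableSet.iInter fun j => MeasurableSet.iInter fun _ =>
    measurable_coord j (measurableSet_singleton _)

/-- Invariance replaces the cylinder by its preimage, which splits disjointly according to the new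
first letter. This is the only form in which invariance enters the stability of `GibbsBand`. -/
theorem measureReal_cyl_eq_sum [Fintype 𝒜] {μ : Measure (MarkovShift S)} [IsFiniteMeasure μ]
    (hμ : MeasurePreserving (shift S) μ μ) (ω : MarkovShift S) {n : ℕ} (hn : 1 ≤ n) :
    μ.real (cyl ω n) =
      ∑ a with S a (ω.1 0) = 1, μ.real (cyl (prepend S a ω) (n + 1)) := by
  rw [← hμ.measureReal_preimage (measurableSet_cyl ω n).nullMeasurableSet,
    shift_preimage_cyl ω hn, measureReal_biUnion_finset]
  · intro a ha b hb hab
    simp only [Finset.coe_filter, Finset.mem_univ, true_and, Set.mem_ofPred_eq] at ha hb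
    refine Set.disjoint_left.2 fun γ h1 h2 => hab ?_
    rw [← prepend_zero ha, ← prepend_zero hb, ← h1 0 (by omega), ← h2 0 (by omega)]
  · exact fun a _ => measurableSet_cyl _ _

variable [Countable 𝒜]

theorem measurableSet_admissible (a : 𝒜) : MeasurableSet {ω : MarkovShift S | S a (ω.1 0) = 1} :=
  measurable_coord 0 (Set.to_countable {b | S a b = 1}).measurableSet

theorem measurable_prepend (a : 𝒜) : Measurable (prepend S a) := by
  classical
  refine measurable_comap_iff.2 (measurable_pi_lambda _ fun j => ?_)
  have h : (fun ω => (prepend S a ω).1 j) = fun ω : MarkovShift S =>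
      if S a (ω.1 0) = 1 then (Nat.casesOn j a ω.1 : 𝒜) else ω.1 j := by
    funext ω
    by_cases hω : S a (ω.1 0) = 1 <;> simp [prepend, hω]
  change Measurable fun ω => (prepend S a ω).1 j
  rw [h]
  refine Measurable.ite (measurableSet_admissible a) ?_ (measurable_coord j)
  cases j with
  | zero => exact measurable_const
  | succ j => exact measurable_coord j

end Measurability

/-! ### Regularity of Hölder potentials -/

theorem seqDist_nonneg (ω γ : MarkovShift S) : 0 ≤ seqDist ω γ := by
  unfold seqDist; split_ifs <;> positivity

theorem seqDist_le {ω γ : MarkovShift S} {n : ℕ} (h : γ ∈ cyl ω n) :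
    seqDist ω γ ≤ (1 / 2) ^ n := by
  unfold seqDist
  split_ifs with he
  · positivity
  · have hne : {j : ℕ | ω.1 j ≠ γ.1 j}.Nonempty := by
      by_contra hc
      refine he (Subtype.ext (funext fun j => ?_))
      by_contra hj
      exact hc ⟨j, hj⟩
    have hn : n ≤ sInf {j : ℕ | ω.1 j ≠ γ.1 j} := by
      by_contra hc
      exact Nat.sInf_mem hne (h _ (not_le.1 hc)).symm
    rw [← inv_pow, ← one_div]
    exact pow_le_pow_of_le_one (by norm_num) (by norm_num) hn

/-- The rate is `θ = 2^{-α}`. A one-sided bound suffices because lying in a common cylinder is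
symmetric. -/
theorem IsHolder.exists_variation {φ : MarkovShift S → ℝ} (hφ : IsHolder φ) :
    ∃ C θ : ℝ, 0 ≤ C ∧ 0 < θ ∧ θ < 1 ∧
      ∀ (n : ℕ) (ω γ : MarkovShift S), γ ∈ cyl ω n → φ ω - φ γ ≤ C * θ ^ n := by
  obtain ⟨C, α, hα, h⟩ := hφ
  refine ⟨|C|, (1 / 2) ^ α, abs_nonneg _, by positivity,
    Real.rpow_lt_one (by norm_num) (by norm_num) hα, fun n ω γ hγ => ?_⟩
  calc φ ω - φ γ ≤ |φ ω - φ γ| := le_abs_self _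
    _ ≤ C * seqDist ω γ ^ α := h ω γ
    _ ≤ |C| * seqDist ω γ ^ α := by
      gcongr
      · exact Real.rpow_nonneg (seqDist_nonneg _ _) _
      · exact le_abs_self C
    _ ≤ |C| * ((1 / 2) ^ n) ^ α := by
      gcongr
      · exact seqDist_nonneg _ _
      · exact seqDist_le hγ
    _ = |C| * ((1 / 2) ^ α) ^ n := by
      rw [← Real.rpow_natCast, ← Real.rpow_natCast, ← Real.rpow_mul (by norm_num),
        ← Real.rpow_mul (by norm_num), mul_comm α]

theorem continuous_shift [TopologicalSpace 𝒜] : Continuous (shift S) :=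
  continuous_induced_rng.2 (continuous_pi fun j =>
    (continuous_apply (j + 1)).comp continuous_subtype_val)

theorem compactSpace_markovShift [Finite 𝒜] [TopologicalSpace 𝒜] [DiscreteTopology 𝒜] :
    CompactSpace (MarkovShift S) := by
  have h : {ω : ℕ → 𝒜 | ∀ j, S (ω j) (ω (j + 1)) = 1} =
      ⋂ j, (fun ω : ℕ → 𝒜 => (ω j, ω (j + 1))) ⁻¹' {p | S p.1 p.2 = 1} := by
    ext ω; simp
  have hclosed : IsClosed {ω : ℕ → 𝒜 | ∀ j, S (ω j) (ω (j + 1)) = 1} := by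
    rw [h]
    exact isClosed_iInter fun j => (isClosed_discrete _).preimage
      ((continuous_apply j).prodMk (continuous_apply (j + 1)))
  exact isCompact_iff_compactSpace.1 hclosed.isCompact

theorem cyl_mem_nhds [TopologicalSpace 𝒜] [DiscreteTopology 𝒜] (ω : MarkovShift S) (n : ℕ) :
    cyl ω n ∈ nhds ω := by
  have : cyl ω n = ⋂ j ∈ Finset.range n, (fun γ : MarkovShift S => γ.1 j) ⁻¹' {ω.1 j} := by
    ext γ; simp [cyl]
  rw [this, Filter.biInter_finset_mem]
  intro j _
  exact ((continuous_apply j).comp continuous_subtype_val).continuousAt.preimage_mem_nhds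
    (by simp)

/-- A function whose variation on `n`-cylinders tends to `0` is continuous. -/
theorem continuous_of_variation [TopologicalSpace 𝒜] [DiscreteTopology 𝒜]
    {f : MarkovShift S → ℝ} {ε : ℕ → ℝ} (hε : Filter.Tendsto ε Filter.atTop (nhds 0))
    (hf : ∀ (n : ℕ) (ω γ : MarkovShift S), 1 ≤ n → γ ∈ cyl ω n → f ω - f γ ≤ ε n) :
    Continuous f := by
  refine continuous_iff_continuousAt.2 fun ω => Metric.tendsto_nhds.2 fun δ hδ => ?_
  obtain ⟨n, hn, hn1⟩ := ((hε.eventually (gt_mem_nhds hδ)).and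
    (Filter.eventually_ge_atTop 1)).exists
  filter_upwards [cyl_mem_nhds ω n] with γ hγ
  rw [Real.dist_eq, abs_lt]
  have h1 := hf n ω γ hn1 hγ
  have h2 := hf n γ ω hn1 (mem_cyl_comm.1 hγ)
  constructor <;> linarith

/-! ### The transfer operator and its fixed point -/

section Transfer

variable (ψ : MarkovShift S → ℝ)

/-- The cone of functions `f` with `f ω ≤ exp (D θⁿ) f γ` for all `ω`, `γ` in a common `n`-cylinder
with `n ≥ 1`, that are nonnegative. -/
def DistortionCone (D θ : ℝ) : Set (MarkovShift S → ℝ) :=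
  {f | (∀ ω, 0 ≤ f ω) ∧ ∀ (n : ℕ) (ω γ : MarkovShift S), 1 ≤ n → γ ∈ cyl ω n → f ω ≤ Real.exp (D * θ ^ n) * f γ}

/-- The functions `f` for which `exp (Sₙ ψ) f` is comparable to the measure of `n`-cylinders, for
every `n ≥ 1`. -/
def GibbsBand [MeasurableSpace 𝒜] (μ : Measure (MarkovShift S)) (c₁ c₂ : ℝ) :
    Set (MarkovShift S → ℝ) :=
  {f | ∀ (n : ℕ) (ω : MarkovShift S), 1 ≤ n →
    c₁ * (Real.exp (birkhoffSum (shift S) ψ n ω) * f ω) ≤ μ.real (cyl ω n) ∧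
    μ.real (cyl ω n) ≤ c₂ * (Real.exp (birkhoffSum (shift S) ψ n ω) * f ω)}

variable {ψ}

theorem isClosed_distortionCone (D θ : ℝ) : IsClosed (DistortionCone (S := S) D θ) := by
  simp only [DistortionCone, Set.ofPred_and, Set.ofPred_forall]
  refine IsClosed.inter (isClosed_iInter fun ω => isClosed_le continuous_const (continuous_apply ω))
    (isClosed_iInter fun n => isClosed_iInter fun ω => isClosed_iInter fun γ =>
      isClosed_iInter fun _ => isClosed_iInter fun _ => isClosed_le (continuous_apply _)
        (continuous_const.mul (continuous_apply _)))

theorem isClosed_gibbsBand [MeasurableSpace 𝒜] (μ : Measure (MarkovShift S)) (c₁ c₂ : ℝ) :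
    IsClosed (GibbsBand ψ μ c₁ c₂) := by
  simp only [GibbsBand, Set.ofPred_and, Set.ofPred_forall]
  refine isClosed_iInter fun n => isClosed_iInter fun ω => isClosed_iInter fun _ => IsClosed.inter
    (isClosed_le (continuous_const.mul (continuous_const.mul (continuous_apply _)))
      continuous_const)
    (isClosed_le continuous_const (continuous_const.mul (continuous_const.mul (continuous_apply _))))

theorem convex_distortionCone (D θ : ℝ) : Convex ℝ (DistortionCone (S := S) D θ) := by
  intro f hf g hg s t hs ht _
  refine ⟨fun ω => add_nonneg (mul_nonneg hs (hf.1 ω)) (mul_nonneg ht (hg.1 ω)),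
    fun n ω γ hn hγ => ?_⟩
  have h1 := mul_le_mul_of_nonneg_left (hf.2 n ω γ hn hγ) hs
  have h2 := mul_le_mul_of_nonneg_left (hg.2 n ω γ hn hγ) ht
  simp only [Pi.add_apply, Pi.smul_apply, smul_eq_mul]
  linarith

theorem convex_gibbsBand [MeasurableSpace 𝒜] (μ : Measure (MarkovShift S)) (c₁ c₂ : ℝ) :
    Convex ℝ (GibbsBand ψ μ c₁ c₂) := by
  intro f hf g hg s t hs ht hst n ω hn
  have h1 := mul_le_mul_of_nonneg_left (hf n ω hn).1 hs
  have h2 := mul_le_mul_of_nonneg_left (hg n ω hn).1 ht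
  have h3 := mul_le_mul_of_nonneg_left (hf n ω hn).2 hs
  have h4 := mul_le_mul_of_nonneg_left (hg n ω hn).2 ht
  have h5 : s * μ.real (cyl ω n) + t * μ.real (cyl ω n) = μ.real (cyl ω n) := by
    rw [← add_mul, hst, one_mul]
  simp only [Pi.add_apply, Pi.smul_apply, smul_eq_mul]
  constructor <;> linarith

/-- Both `f` and `1` are compared with the same measure of a `1`-cylinder, so the exponential factor
cancels. -/
theorem gibbsBand_bounds [MeasurableSpace 𝒜] {μ : Measure (MarkovShift S)} {c₁ c₂ : ℝ}
    (h₁ : 0 < c₁) (h₂ : 0 < c₂) (h1 : (1 : MarkovShift S → ℝ) ∈ GibbsBand ψ μ c₁ c₂)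
    {f : MarkovShift S → ℝ} (hf : f ∈ GibbsBand ψ μ c₁ c₂) (ω : MarkovShift S) :
    f ω ∈ Set.Icc (c₁ / c₂) (c₂ / c₁) := by
  obtain ⟨ha, hb⟩ := hf 1 ω le_rfl
  obtain ⟨hc, hd⟩ := h1 1 ω le_rfl
  have he := Real.exp_pos (birkhoffSum (shift S) ψ 1 ω)
  simp only [Pi.one_apply, mul_one] at hc hd
  rw [Set.mem_Icc, div_le_iff₀ h₂, le_div_iff₀ h₁]
  constructor
  · refine le_of_mul_le_mul_left ?_ he
    linarith
  · refine le_of_mul_le_mul_left ?_ he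
    linarith

variable [Fintype 𝒜]

variable (ψ) in
/-- The transfer (Ruelle) operator `(L f)(ω) = ∑_{a ω admissible} e^{ψ(aω)} f(aω)`. -/
noncomputable def transfer (f : MarkovShift S → ℝ) (ω : MarkovShift S) : ℝ :=
  ∑ a with S a (ω.1 0) = 1, Real.exp (ψ (prepend S a ω)) * f (prepend S a ω)

/-- Points with the same first letter have the same inverse branches, and prepending a letter
lengthens the common cylinder by one. The constant `D` solves `D = (C + D) θ`, so the variation of
`ψ` and that of `f` on the longer cylinder add up to exactly the allowed distortion. -/
theorem transfer_mem_distortionCone {C D θ : ℝ} (hθ : θ < 1) (hD : D = C * θ / (1 - θ))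
    (hψ : ∀ (n : ℕ) (ω γ : MarkovShift S), γ ∈ cyl ω n → ψ ω - ψ γ ≤ C * θ ^ n)
    {f : MarkovShift S → ℝ} (hf : f ∈ DistortionCone D θ) :
    transfer ψ f ∈ DistortionCone D θ := by
  refine ⟨fun ω => Finset.sum_nonneg fun a _ => mul_nonneg (Real.exp_nonneg _) (hf.1 _),
    fun n ω γ hn hγ => ?_⟩
  have h0 : γ.1 0 = ω.1 0 := hγ 0 (by omega)
  unfold transfer
  rw [h0, Finset.mul_sum]
  refine Finset.sum_le_sum fun a ha => ?_
  have hω : S a (ω.1 0) = 1 := by simpa using ha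
  have hm := prepend_mem_cyl hω (by rwa [h0]) hγ
  have h1 := hψ _ _ _ hm
  have h2 := hf.2 _ _ _ (by omega) hm
  have hDe : D * θ ^ n = C * θ ^ (n + 1) + D * θ ^ (n + 1) := by
    have : 1 - θ ≠ 0 := by linarith
    rw [hD]; field_simp; ring
  calc Real.exp (ψ (prepend S a ω)) * f (prepend S a ω)
      ≤ Real.exp (ψ (prepend S a ω)) *
          (Real.exp (D * θ ^ (n + 1)) * f (prepend S a γ)) := by gcongr
    _ = Real.exp (ψ (prepend S a ω) + D * θ ^ (n + 1)) * f (prepend S a γ) := by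
      rw [Real.exp_add]; ring
    _ ≤ Real.exp (D * θ ^ n + ψ (prepend S a γ)) * f (prepend S a γ) := by
      refine mul_le_mul_of_nonneg_right (Real.exp_le_exp.2 ?_) (hf.1 _)
      linarith
    _ = _ := by rw [Real.exp_add]; ring

/-- Since `S_{n+1} ψ (aω) = ψ (aω) + S_n ψ (ω)`, summing the band inequalities of level `n + 1` over
the branches gives those of level `n`. -/
theorem transfer_mem_gibbsBand [MeasurableSpace 𝒜] [MeasurableSingletonClass 𝒜]
    {μ : Measure (MarkovShift S)} [IsFiniteMeasure μ] (hμ : MeasurePreserving (shift S) μ μ)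
    {c₁ c₂ : ℝ} {f : MarkovShift S → ℝ} (hf : f ∈ GibbsBand ψ μ c₁ c₂) :
    transfer ψ f ∈ GibbsBand ψ μ c₁ c₂ := by
  intro n ω hn
  have key : Real.exp (birkhoffSum (shift S) ψ n ω) * transfer ψ f ω =
      ∑ a with S a (ω.1 0) = 1, Real.exp (birkhoffSum (shift S) ψ (n + 1) (prepend S a ω)) *
        f (prepend S a ω) := by
    rw [transfer, Finset.mul_sum]
    refine Finset.sum_congr rfl fun a ha => ?_
    rw [birkhoffSum_succ', shift_prepend (by simpa using ha), Real.exp_add]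
    ring
  rw [key, Finset.mul_sum, Finset.mul_sum, measureReal_cyl_eq_sum hμ ω hn]
  exact ⟨Finset.sum_le_sum fun a _ => (hf (n + 1) _ (by omega)).1,
    Finset.sum_le_sum fun a _ => (hf (n + 1) _ (by omega)).2⟩

theorem transfer_smul (c : ℝ) (f : MarkovShift S → ℝ) :
    transfer ψ (c • f) = c • transfer ψ f := by
  funext ω
  simp only [transfer, Pi.smul_apply, smul_eq_mul, Finset.mul_sum]
  exact Finset.sum_congr rfl fun a _ => by ring

theorem transfer_sum {ι : Type*} (s : Finset ι) (f : ι → MarkovShift S → ℝ) :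
    transfer ψ (∑ i ∈ s, f i) = ∑ i ∈ s, transfer ψ (f i) := by
  funext ω
  simp only [transfer, Finset.sum_apply, Finset.mul_sum]
  exact Finset.sum_comm

theorem continuous_transfer : Continuous (transfer ψ : (MarkovShift S → ℝ) → _) :=
  continuous_pi fun _ => continuous_finsetSum _ fun _ _ =>
    continuous_const.mul (continuous_apply _)

/-- The transfer operator has a fixed point in every invariant closed convex set of uniformly bounded
functions that contains `1`, namely the limit of the Cesàro means of `Lⁿ 1` along an ultrafilter. -/
theorem exists_transfer_eq_self {K : Set (MarkovShift S → ℝ)} (hK : IsClosed K) (hc : Convex ℝ K)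
    {a b : ℝ} (hab : ∀ f ∈ K, ∀ ω, f ω ∈ Set.Icc a b) (hL : ∀ f ∈ K, transfer ψ f ∈ K)
    (h1 : (1 : MarkovShift S → ℝ) ∈ K) : ∃ h ∈ K, transfer ψ h = h := by
  have hit : ∀ n, (transfer ψ)^[n] 1 ∈ K := fun n => by
    induction n with
    | zero => exact h1
    | succ n ih => rw [Function.iterate_succ_apply']; exact hL _ ih
  let A : ℕ → MarkovShift S → ℝ := fun n =>
    ((n + 1 : ℕ) : ℝ)⁻¹ • ∑ k ∈ Finset.range (n + 1), (transfer ψ)^[k] 1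
  have hA : ∀ n, A n ∈ K := fun n => by
    have hn : ((n + 1 : ℕ) : ℝ) ≠ 0 := by positivity
    simp only [A, Finset.smul_sum]
    refine hc.sum_mem (fun _ _ => by positivity) ?_ fun k _ => hit k
    rw [Finset.sum_const, Finset.card_range, nsmul_eq_mul, mul_inv_cancel₀ hn]
  -- Tychonoff: `K` is closed in a product of compact intervals. The index set may be uncountable,
  -- hence an ultrafilter instead of a subsequence.
  have hcomp : IsCompact K :=
    (isCompact_univ_pi fun _ => isCompact_Icc (a := a) (b := b)).of_isClosed_subset hK
      fun f hf ω _ => hab f hf ω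
  obtain ⟨h, hhK, hh⟩ := hcomp.ultrafilter_le_nhds ((Filter.hyperfilter ℕ).map A)
    (Filter.tendsto_principal.2 (Filter.Eventually.of_forall hA))
  have hlim : Filter.Tendsto A (Filter.hyperfilter ℕ) (nhds h) := hh
  have hd : Filter.Tendsto (fun n => transfer ψ (A n) - A n) Filter.atTop (nhds 0) := by
    refine tendsto_pi_nhds.2 fun ω => ?_
    -- The sum telescopes, leaving a bounded quantity divided by `n + 1`.
    have heq : ∀ n, (transfer ψ (A n) - A n) ω =
        ((n + 1 : ℕ) : ℝ)⁻¹ * ((transfer ψ)^[n + 1] 1 ω - 1) := fun n => by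
      simp only [A, transfer_smul, transfer_sum, ← Function.iterate_succ_apply']
      rw [← smul_sub, ← Finset.sum_sub_distrib,
        Finset.sum_range_sub fun k => (transfer ψ)^[k] (1 : MarkovShift S → ℝ)]
      simp
    simp only [heq, Pi.zero_apply]
    refine Filter.Tendsto.zero_mul_isBoundedUnder_le
      ((tendsto_inv_atTop_nhds_zero_nat (𝕜 := ℝ)).comp (Filter.tendsto_add_atTop_nat 1)) ?_
    refine Filter.isBoundedUnder_of ⟨|a - 1| + |b - 1|, fun n => ?_⟩
    have := hab _ (hit (n + 1)) ω
    simp only [Function.comp, Real.norm_eq_abs]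
    rw [abs_le]
    constructor
    · linarith [this.1, neg_abs_le (a - 1), abs_nonneg (b - 1)]
    · linarith [this.2, le_abs_self (b - 1), abs_nonneg (a - 1)]
  refine ⟨h, hhK, ?_⟩
  have h2 := ((continuous_transfer (ψ := ψ)).tendsto h).comp hlim |>.sub hlim
  exact sub_eq_zero.1 (tendsto_nhds_unique h2 (hd.mono_left Nat.hyperfilter_le_atTop))

end Transfer

/-! ### Measures on cylinders -/

section Truncate

/-- The word formed by the first `n` letters of a sequence. -/
def truncate (n : ℕ) (ω : MarkovShift S) : Fin n → 𝒜 := fun i => ω.1 i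

theorem truncate_preimage_singleton (n : ℕ) (ω : MarkovShift S) :
    truncate n ⁻¹' {truncate n ω} = cyl ω n := by
  ext γ
  exact ⟨fun h j hj => congrFun h ⟨j, hj⟩, fun h => funext fun i => h i i.2⟩

variable [MeasurableSpace 𝒜]

theorem measurable_truncate (n : ℕ) : Measurable (truncate n : MarkovShift S → _) :=
  measurable_pi_lambda _ fun i => measurable_coord i

variable [Fintype 𝒜] [MeasurableSingletonClass 𝒜]

theorem integrable_comp_truncate (ν : Measure (MarkovShift S)) [IsFiniteMeasure ν] {n : ℕ}
    (f : (Fin n → 𝒜) → ℝ) : Integrable (fun ω => f (truncate n ω)) ν :=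
  (Integrable.of_finite (f := f)).comp_measurable (measurable_truncate n)

theorem integral_comp_truncate (ν : Measure (MarkovShift S)) [IsFiniteMeasure ν] {n : ℕ}
    (f : (Fin n → 𝒜) → ℝ) :
    ∫ ω, f (truncate n ω) ∂ν = ∑ w, ν.real (truncate n ⁻¹' {w}) * f w := by
  classical
  rw [← integral_map (measurable_truncate n).aemeasurable
    (measurable_of_finite f).aestronglyMeasurable, integral_fintype Integrable.of_finite]
  refine Finset.sum_congr rfl fun w _ => ?_
  rw [map_measureReal_apply (measurable_truncate n) (measurableSet_singleton w), smul_eq_mul]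

theorem integrable_log_cyl (μ ν : Measure (MarkovShift S)) [IsFiniteMeasure μ] (n : ℕ) :
    Integrable (fun ω => Real.log (ν.real (cyl ω n))) μ := by
  simpa only [truncate_preimage_singleton] using
    integrable_comp_truncate μ fun w : Fin n → 𝒜 => Real.log (ν.real (truncate n ⁻¹' {w}))

/-- The Gibbs variational inequality for two measures on words of length `n`, tested against a
multiple of the indicator of a cylinder. -/
theorem gibbs_variational (μ ρ : Measure (MarkovShift S)) [IsProbabilityMeasure μ]
    [IsProbabilityMeasure ρ] {n k : ℕ} (hk : k ≤ n) (hμ : ∀ ω, 0 < μ.real (cyl ω n))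
    (hρ : ∀ ω, 0 < ρ.real (cyl ω n)) (e : MarkovShift S) (t : ℝ) :
    t * μ.real (cyl e k) +
        ∫ ω, (Real.log (ρ.real (cyl ω n)) - Real.log (μ.real (cyl ω n))) ∂μ ≤
      (Real.exp t - 1) * ρ.real (cyl e k) := by
  classical
  -- The test function `t · 1_{cyl e k}` depends only on the first `n` letters because `k ≤ n`, so
  -- everything reduces to finite sums over words.
  let u : (Fin n → 𝒜) → ℝ := fun w => if ∀ i : Fin n, (i : ℕ) < k → w i = e.1 i then t else 0
  let F : (Fin n → 𝒜) → ℝ := fun w => μ.real (truncate n ⁻¹' {w})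
  let R : (Fin n → 𝒜) → ℝ := fun w => ρ.real (truncate n ⁻¹' {w})
  have hmem : ∀ ω : MarkovShift S,
      (∀ i : Fin n, (i : ℕ) < k → truncate n ω i = e.1 i) ↔ ω ∈ cyl e k := fun ω =>
    ⟨fun h j hj => h ⟨j, hj.trans_le hk⟩ hj, fun h i hi => h i hi⟩
  have hu : ∀ ω, u (truncate n ω) = (cyl e k).indicator (fun _ => t) ω := fun ω => by
    simp only [u, hmem, Set.indicator_apply]
  have hexp : ∀ ω, Real.exp (u (truncate n ω)) =
      (cyl e k).indicator (fun _ => Real.exp t - 1) ω + 1 := fun ω => by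
    rw [hu]
    by_cases h : ω ∈ cyl e k <;> simp [h]
  have hF : ∀ ω, F (truncate n ω) = μ.real (cyl ω n) := fun ω => by
    simp only [F, truncate_preimage_singleton]
  have hR : ∀ ω, R (truncate n ω) = ρ.real (cyl ω n) := fun ω => by
    simp only [R, truncate_preimage_singleton]
  have hlhs : t * μ.real (cyl e k) +
        ∫ ω, (Real.log (ρ.real (cyl ω n)) - Real.log (μ.real (cyl ω n))) ∂μ =
      ∫ ω, (u (truncate n ω) + (Real.log (ρ.real (cyl ω n)) - Real.log (μ.real (cyl ω n)))) ∂μ := by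
    have h := integral_add (integrable_comp_truncate μ u)
      ((integrable_log_cyl μ ρ n).sub (integrable_log_cyl μ μ n))
    simp only [Pi.sub_apply] at h
    rw [h]
    simp only [hu]
    rw [integral_indicator_const _ (measurableSet_cyl e k), smul_eq_mul, mul_comm]
  let v : (Fin n → 𝒜) → ℝ := fun w => Real.exp (u w) * R w / F w - 1
  calc _ = _ := hlhs
    _ ≤ ∫ ω, v (truncate n ω) ∂μ := by
      refine integral_mono ((integrable_comp_truncate μ u).add
        ((integrable_log_cyl μ ρ n).sub (integrable_log_cyl μ μ n)))
        (integrable_comp_truncate μ v) fun ω => ?_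
      -- The inequality `log x ≤ x - 1` is applied to `x = e^u ρ / μ`.
      have h := Real.log_le_sub_one_of_pos
        (div_pos (mul_pos (Real.exp_pos (u (truncate n ω))) (hρ ω)) (hμ ω))
      rw [Real.log_div (mul_pos (Real.exp_pos _) (hρ ω)).ne' (hμ ω).ne',
        Real.log_mul (Real.exp_pos _).ne' (hρ ω).ne', Real.log_exp] at h
      simp only [v, hF, hR]
      linarith
    _ = ∑ w, F w * v w := integral_comp_truncate μ v
    _ ≤ ∑ w, (R w * Real.exp (u w) - F w * 1) := by
      refine Finset.sum_le_sum fun w _ => ?_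
      -- For words of zero `μ`-mass the quotient in `v` has the default value `0`; the left side
      -- vanishes and only the inequality survives.
      rcases eq_or_ne (F w) 0 with h | h
      · rw [h, zero_mul, zero_mul, sub_zero]
        exact mul_nonneg measureReal_nonneg (Real.exp_nonneg _)
      · refine le_of_eq ?_
        simp only [v]
        field_simp
    _ = ∫ ω, Real.exp (u (truncate n ω)) ∂ρ - 1 := by
      rw [Finset.sum_sub_distrib, ← integral_comp_truncate μ fun _ : Fin n → 𝒜 => (1 : ℝ),
        integral_comp_truncate ρ fun w => Real.exp (u w)]
      simp [R]
    _ = (Real.exp t - 1) * ρ.real (cyl e k) := by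
      simp only [hexp]
      rw [integral_add ((integrable_const _).indicator (measurableSet_cyl e k))
        (integrable_const _), integral_indicator_const _ (measurableSet_cyl e k)]
      simp [mul_comm]

/-- Two finite measures on `Ω_S` that agree on cylinders coincide. -/
theorem ext_of_cyl {μ ρ : Measure (MarkovShift S)} [IsFiniteMeasure μ]
    (h : ∀ ω n, μ (cyl ω n) = ρ (cyl ω n)) (hne : Nonempty (MarkovShift S)) : μ = ρ := by
  let 𝒞 : Set (Set (MarkovShift S)) := {C | ∃ ω n, C = cyl ω n}
  obtain ⟨ω₀⟩ := hne
  refine ext_of_generate_finite 𝒞 (le_antisymm ?_ ?_) ?_ ?_ ?_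
  · have hcoord : ∀ j, Measurable[MeasurableSpace.generateFrom 𝒞]
        fun ω : MarkovShift S => ω.1 j := by
      intro j s _
      have : (fun ω : MarkovShift S => ω.1 j) ⁻¹' s =
          ⋃ w ∈ {w : Fin (j + 1) → 𝒜 | w (Fin.last j) ∈ s}, truncate (j + 1) ⁻¹' {w} := by
        ext ω
        simp [truncate]
      rw [this]
      refine MeasurableSet.biUnion (Set.to_countable _) fun w _ => ?_
      rcases (truncate (j + 1) ⁻¹' {w} : Set (MarkovShift S)).eq_empty_or_nonempty with he | ⟨ω, hω⟩
      · rw [he]; exact @MeasurableSet.empty _ (MeasurableSpace.generateFrom 𝒞)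
      · obtain rfl : truncate (j + 1) ω = w := hω
        rw [truncate_preimage_singleton]
        exact MeasurableSpace.measurableSet_generateFrom ⟨ω, j + 1, rfl⟩
    exact (@measurable_pi_lambda _ _ _ (MeasurableSpace.generateFrom 𝒞) _ _ hcoord).comap_le
  · refine MeasurableSpace.generateFrom_le ?_
    rintro _ ⟨ω, n, rfl⟩
    exact measurableSet_cyl ω n
  -- Cylinders that meet can be recentred at a common point, and are then nested.
  · rintro _ ⟨ω, n, rfl⟩ _ ⟨γ, m, rfl⟩ ⟨x, hx, hy⟩
    rw [← cyl_eq_of_mem hx, ← cyl_eq_of_mem hy]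
    rcases le_total n m with hnm | hnm
    · exact ⟨x, m, Set.inter_eq_right.2 (cyl_anti x hnm)⟩
    · exact ⟨x, n, Set.inter_eq_left.2 (cyl_anti x hnm)⟩
  · rintro _ ⟨ω, n, rfl⟩
    exact h ω n
  · have : cyl ω₀ 0 = Set.univ := by ext; simp [cyl]
    rw [← this]
    exact h ω₀ 0

/-! ### The measure `μ ∘ T` -/

theorem compShift_eq_sum_map (μ : Measure (MarkovShift S)) :
    compShift μ = ∑ a, (μ.restrict {ω | S a (ω.1 0) = 1}).map (prepend S a) := by
  ext E hE
  rw [compShift_apply μ hE, tsum_fintype, Measure.coe_finsetSum, Finset.sum_apply]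
  refine Finset.sum_congr rfl fun a _ => ?_
  rw [Measure.map_apply (measurable_prepend a) hE,
    Measure.restrict_apply (measurable_prepend a hE)]
  congr 1
  ext ω
  constructor
  · rintro ⟨γ, ⟨hγ, rfl⟩, rfl⟩
    refine ⟨?_, γ.2 0⟩
    rwa [Set.mem_preimage, prepend_shift]
  · rintro ⟨hω, ha⟩
    exact ⟨prepend S a ω, ⟨hω, prepend_zero ha⟩, shift_prepend ha⟩

instance isFiniteMeasure_compShift (μ : Measure (MarkovShift S)) [IsFiniteMeasure μ] :
    IsFiniteMeasure (compShift μ) := by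
  rw [compShift_eq_sum_map]
  infer_instance

/-- Integration against `μ ∘ T` is integration against `μ` of the sum over inverse branches;
normalisation of `γ` thus becomes total mass `1` of the measure with density `e^γ`. -/
theorem lintegral_compShift (μ : Measure (MarkovShift S)) {f : MarkovShift S → ENNReal}
    (hf : Measurable f) :
    ∫⁻ ω, f ω ∂compShift μ = ∫⁻ ω, ∑ a with S a (ω.1 0) = 1, f (prepend S a ω) ∂μ := by
  have hm : ∀ a, Measurable fun ω => f (prepend S a ω) := fun a => hf.comp (measurable_prepend a)
  simp only [Finset.sum_filter]
  rw [compShift_eq_sum_map, lintegral_finsetSum_measure, lintegral_finsetSum]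
  · refine Finset.sum_congr rfl fun a _ => ?_
    rw [lintegral_map hf (measurable_prepend a), ← lintegral_indicator (measurableSet_admissible a)]
    simp only [Set.indicator_apply, Set.mem_ofPred_eq]
  · exact fun a _ => Measurable.ite (measurableSet_admissible a) (hm a) measurable_const

theorem compShift_cyl_succ (μ : Measure (MarkovShift S)) (ω : MarkovShift S) {n : ℕ} (hn : 1 ≤ n) :
    compShift μ (cyl ω (n + 1)) = μ (cyl (shift S ω) n) := by
  rw [compShift_apply μ (measurableSet_cyl ω _), tsum_fintype, Finset.sum_eq_single (ω.1 0)]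
  · have : cyl ω (n + 1) ⊆ letterCyl S (ω.1 0) := fun γ hγ => hγ 0 (by omega)
    rw [Set.inter_eq_left.2 this, shift_image_cyl_succ ω hn]
  · intro a _ ha
    have : cyl ω (n + 1) ∩ letterCyl S a = ∅ :=
      Set.eq_empty_of_forall_notMem fun γ hγ => ha (hγ.2.symm.trans (hγ.1 0 (by omega)))
    rw [this, Set.image_empty, measure_empty]
  · simp

end Truncate

/-! ### Uniqueness of the normalised potential -/

theorem integral_comp_of_measurePreserving {X : Type*} [MeasurableSpace X] {μ : Measure X}
    {T : X → X} (hT : MeasurePreserving T μ μ) {f : X → ℝ} (hf : Integrable f μ) :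
    ∫ x, f (T x) ∂μ = ∫ x, f x ∂μ := by
  have h := integral_map hT.aemeasurable (f := f)
    (by rw [hT.map_eq]; exact hf.aestronglyMeasurable)
  rw [hT.map_eq] at h
  exact h.symm

/-- If `d > 0`, then eventually `b` increases by at least `d / 2` at each step, against its upper
bound. -/
theorem nonpos_of_le_sub_add {b ε : ℕ → ℝ} {d K : ℝ} {m : ℕ} (hb : ∀ n, b n ≤ K)
    (hε : Filter.Tendsto ε Filter.atTop (nhds 0))
    (h : ∀ n, m ≤ n → d ≤ b (n + 1) - b n + ε n) : d ≤ 0 := by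
  by_contra! hd
  obtain ⟨N, hN⟩ := Filter.eventually_atTop.1
    ((hε.eventually (gt_mem_nhds (half_pos hd))).and (Filter.eventually_ge_atTop m))
  have hgrow : ∀ j : ℕ, b N + j * (d / 2) ≤ b (N + j) := fun j => by
    induction j with
    | zero => simp
    | succ j ih =>
      obtain ⟨h1, h2⟩ := hN (N + j) (by omega)
      have h3 := h (N + j) h2
      rw [← add_assoc]
      push_cast
      linarith
  obtain ⟨j, hj⟩ := Archimedean.arch (K - b N + 1) (half_pos hd)
  rw [nsmul_eq_mul] at hj
  linarith [hgrow j, hb (N + j)]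

/-- Both sides vanish at `t = 0`, so their difference has a minimum there and its derivative `y - x`
is zero. -/
theorem eq_of_forall_mul_le_exp_sub_one_mul {x y : ℝ}
    (h : ∀ t : ℝ, t * x ≤ (Real.exp t - 1) * y) : x = y := by
  have hd : HasDerivAt (fun t => (Real.exp t - 1) * y - t * x) (Real.exp 0 * y - 1 * x) 0 :=
    (((Real.hasDerivAt_exp 0).sub_const 1).mul_const y).sub ((hasDerivAt_id 0).mul_const x)
  have hmin : IsLocalMin (fun t => (Real.exp t - 1) * y - t * x) 0 :=
    Filter.Eventually.of_forall fun t => by simpa using h t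
  have := hmin.hasDerivAt_eq_zero hd
  rw [Real.exp_zero] at this
  linarith

variable [Fintype 𝒜] [MeasurableSpace 𝒜] [MeasurableSingletonClass 𝒜]

/-- If `γ` is normalised, `∑_{Tη = ω} e^{γ η} = 1`, has variations tending to `0`, and the invariant
measure `μ` has the upper Gibbs bound for a potential with the same integral as `γ`, then
`e^γ` is the density of `μ` with respect to `μ ∘ T`. -/
theorem withDensity_exp_eq {μ : Measure (MarkovShift S)} [IsProbabilityMeasure μ]
    (hμ : MeasurePreserving (shift S) μ μ) (hpos : ∀ ω n, 0 < μ.real (cyl ω n))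
    {ψ γ : MarkovShift S → ℝ} {ε : ℕ → ℝ} {c : ℝ} (hc : 0 < c)
    (hψ : Integrable ψ μ) (hγm : Measurable γ) (hγi : Integrable γ μ)
    (hint : ∫ ω, γ ω ∂μ = ∫ ω, ψ ω ∂μ)
    (hub : ∀ ω n, μ.real (cyl ω n) ≤ c * Real.exp (birkhoffSum (shift S) ψ n ω))
    (hε : Filter.Tendsto ε Filter.atTop (nhds 0))
    (hvar : ∀ (n : ℕ) (ω η : MarkovShift S), 1 ≤ n → η ∈ cyl ω (n + 1) → γ ω - γ η ≤ ε n)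
    (hnorm : ∀ ω : MarkovShift S, ∑ a with S a (ω.1 0) = 1, Real.exp (γ (prepend S a ω)) = 1) :
    (compShift μ).withDensity (fun ω => ENNReal.ofReal (Real.exp (γ ω))) = μ := by
  set ρ := (compShift μ).withDensity (fun ω => ENNReal.ofReal (Real.exp (γ ω))) with hρdef
  have hne : Nonempty (MarkovShift S) := μ.nonempty_of_neZero
  have hprob : IsProbabilityMeasure ρ := by
    refine ⟨?_⟩
    rw [hρdef, withDensity_apply _ MeasurableSet.univ, Measure.restrict_univ,
      lintegral_compShift μ hγm.exp.ennreal_ofReal]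
    simp only [← ENNReal.ofReal_sum_of_nonneg fun _ _ => Real.exp_nonneg _, hnorm,
      ENNReal.ofReal_one, lintegral_one, measure_univ]
  -- On the cylinder the density is at least `e^{γ ω - ε n}`, and `μ ∘ T` gives this cylinder the
  -- mass of its image.
  have hlow : ∀ (ω : MarkovShift S) (n : ℕ), 1 ≤ n →
      Real.exp (γ ω - ε n) * μ.real (cyl (shift S ω) n) ≤ ρ.real (cyl ω (n + 1)) := by
    intro ω n hn
    have h : ENNReal.ofReal (Real.exp (γ ω - ε n)) * μ (cyl (shift S ω) n) ≤
        ρ (cyl ω (n + 1)) := by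
      rw [hρdef, withDensity_apply _ (measurableSet_cyl _ _), ← compShift_cyl_succ μ ω hn,
        ← setLIntegral_const]
      refine setLIntegral_mono hγm.exp.ennreal_ofReal fun η hη => ENNReal.ofReal_le_ofReal ?_
      rw [Real.exp_le_exp]
      linarith [hvar n ω η hn hη]
    have := ENNReal.toReal_mono (measure_ne_top _ _) h
    rwa [ENNReal.toReal_mul, ENNReal.toReal_ofReal (Real.exp_nonneg _)] at this
  have hρpos : ∀ (ω : MarkovShift S) (n : ℕ), 1 ≤ n → 0 < ρ.real (cyl ω (n + 1)) :=
    fun ω n hn => (mul_pos (Real.exp_pos _) (hpos _ _)).trans_le (hlow ω n hn)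
  let a : ℕ → ℝ := fun n => ∫ ω, Real.log (μ.real (cyl ω n)) ∂μ
  have hshift : ∀ n, Integrable (fun ω => Real.log (μ.real (cyl (shift S ω) n))) μ ∧
      ∫ ω, Real.log (μ.real (cyl (shift S ω) n)) ∂μ = a n := fun n => by
    have hi := integrable_log_cyl μ μ n
    refine ⟨hμ.integrable_comp_of_integrable hi, ?_⟩
    exact integral_comp_of_measurePreserving hμ hi
  have hbirk : ∀ n, Integrable (fun ω => birkhoffSum (shift S) ψ n ω) μ ∧
      ∫ ω, birkhoffSum (shift S) ψ n ω ∂μ = n * ∫ ω, ψ ω ∂μ := fun n => by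
    have hit : ∀ k, Integrable (fun ω => ψ ((shift S)^[k] ω)) μ := fun k =>
      (hμ.iterate k).integrable_comp_of_integrable hψ
    refine ⟨integrable_finsetSum _ fun k _ => hit k, ?_⟩
    simp only [birkhoffSum]
    rw [integral_finsetSum _ fun k _ => hit k, Finset.sum_congr rfl fun k _ => ?_,
      Finset.sum_const, Finset.card_range, nsmul_eq_mul]
    exact integral_comp_of_measurePreserving (hμ.iterate k) hψ
  -- The upper Gibbs bound is stated for `ψ`; equality of the two integrals turns it into a bound
  -- involving `γ`.
  have ha : ∀ n : ℕ, a n - n * ∫ ω, γ ω ∂μ ≤ Real.log c := by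
    intro n
    have h : a n ≤ ∫ ω, (Real.log c + birkhoffSum (shift S) ψ n ω) ∂μ := by
      refine integral_mono (integrable_log_cyl μ μ n) ((integrable_const _).add (hbirk n).1)
        fun ω => ?_
      have := Real.log_le_log (hpos ω n) (hub ω n)
      rwa [Real.log_mul hc.ne' (Real.exp_pos _).ne', Real.log_exp] at this
    rw [integral_add (integrable_const _) (hbirk n).1, (hbirk n).2, integral_const, probReal_univ,
      one_smul, ← hint] at h
    linarith
  have hmain : ∀ (e : MarkovShift S) (k : ℕ) (t : ℝ),
      t * μ.real (cyl e k) ≤ (Real.exp t - 1) * ρ.real (cyl e k) := by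
    intro e k t
    refine sub_nonpos.1 (nonpos_of_le_sub_add (m := k + 1)
      (b := fun n => a n - n * ∫ ω, γ ω ∂μ) ha hε fun n hn => ?_)
    have hgv := gibbs_variational μ ρ (n := n + 1) (k := k) (by omega) (fun ω => hpos ω _)
      (fun ω => hρpos ω n (by omega)) e t
    have hI := (hγi.sub (integrable_const (ε n))).add (hshift n).1
    have hlog : ∫ ω, (γ ω - ε n + Real.log (μ.real (cyl (shift S ω) n)) -
          Real.log (μ.real (cyl ω (n + 1)))) ∂μ ≤
        ∫ ω, (Real.log (ρ.real (cyl ω (n + 1))) - Real.log (μ.real (cyl ω (n + 1)))) ∂μ := by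
      refine integral_mono (hI.sub (integrable_log_cyl μ μ (n + 1)))
        ((integrable_log_cyl μ ρ (n + 1)).sub (integrable_log_cyl μ μ (n + 1))) fun ω => ?_
      have h := Real.log_le_log (mul_pos (Real.exp_pos _) (hpos _ _)) (hlow ω n (by omega))
      rw [Real.log_mul (Real.exp_pos _).ne' (hpos _ _).ne', Real.log_exp] at h
      exact sub_le_sub_right h _
    have heq : ∫ ω, (γ ω - ε n + Real.log (μ.real (cyl (shift S ω) n)) -
          Real.log (μ.real (cyl ω (n + 1)))) ∂μ = ∫ ω, γ ω ∂μ - ε n + a n - a (n + 1) := by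
      have h1 := integral_sub hI (integrable_log_cyl μ μ (n + 1))
      have h2 := integral_add (hγi.sub (integrable_const (ε n))) (hshift n).1
      have h3 := integral_sub hγi (integrable_const (μ := μ) (ε n))
      simp only [Pi.add_apply, Pi.sub_apply] at h1 h2 h3
      rw [h1, h2, h3, (hshift n).2]
      simp [a]
    push_cast
    linarith
  refine ext_of_cyl (fun e k => ?_) hne
  have h := eq_of_forall_mul_le_exp_sub_one_mul (hmain e k)
  exact ((measureReal_eq_measureReal_iff (measure_ne_top _ _) (measure_ne_top _ _)).1 h).symm

/-! ### The inverse Jacobian of a Gibbs measure -/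

section Topology

variable [TopologicalSpace 𝒜] [DiscreteTopology 𝒜]

theorem IsGibbsMeasure.exists_inverseJacobian_eq {φ : MarkovShift S → ℝ} (hφ : IsHolder φ) {P : ℝ}
    {μ : Measure (MarkovShift S)} (hμ : IsGibbsMeasure φ P μ) :
    ∃ h : MarkovShift S → ℝ, Continuous h ∧ (∀ ω, 0 < h ω) ∧
      ∀ᵐ ω ∂(compShift μ),
        inverseJacobian μ ω = Real.exp (φ ω - P) * (h ω / h (shift S ω)) := by
  have := compactSpace_markovShift (S := S)
  have hprob := hμ.isProbabilityMeasure
  have hinv := hμ.invariant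
  obtain ⟨c₁, c₂, hc₁, hc₂, hgibbs⟩ := hμ.bounds
  obtain ⟨C, θ, hC, hθ0, hθ1, hvar⟩ := hφ.exists_variation
  have hpow : Filter.Tendsto (fun n : ℕ => θ ^ n) Filter.atTop (nhds 0) :=
    tendsto_pow_atTop_nhds_zero_of_lt_one hθ0.le hθ1
  let ψ : MarkovShift S → ℝ := fun ω => φ ω - P
  have hψvar : ∀ (n : ℕ) (ω γ : MarkovShift S), γ ∈ cyl ω n → ψ ω - ψ γ ≤ C * θ ^ n :=
    fun n ω γ hγ => by simpa [ψ] using hvar n ω γ hγ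
  have hbirk : ∀ ω n, -P * n + birkhoffSum (shift S) φ n ω = birkhoffSum (shift S) ψ n ω :=
    fun ω n => by simp [birkhoffSum, ψ]; ring
  have hgibbs' : ∀ ω n, c₁ * Real.exp (birkhoffSum (shift S) ψ n ω) ≤ μ.real (cyl ω n) ∧
      μ.real (cyl ω n) ≤ c₂ * Real.exp (birkhoffSum (shift S) ψ n ω) := fun ω n => by
    have h := hgibbs ω n
    rwa [hbirk, le_div_iff₀ (Real.exp_pos _), div_le_iff₀ (Real.exp_pos _)] at h
  have hone : (1 : MarkovShift S → ℝ) ∈ GibbsBand ψ μ c₁ c₂ := fun n ω _ => by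
    simpa using hgibbs' ω n
  let D : ℝ := C * θ / (1 - θ)
  have hD : 0 ≤ D := div_nonneg (mul_nonneg hC hθ0.le) (by linarith)
  obtain ⟨h, ⟨hcone, hband⟩, hfix⟩ := exists_transfer_eq_self (ψ := ψ)
    ((isClosed_distortionCone D θ).inter (isClosed_gibbsBand (ψ := ψ) μ c₁ c₂))
    ((convex_distortionCone D θ).inter (convex_gibbsBand μ c₁ c₂))
    (fun f hf ω => gibbsBand_bounds hc₁ hc₂ hone hf.2 ω)
    (fun f hf => ⟨transfer_mem_distortionCone hθ1 rfl hψvar hf.1,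
      transfer_mem_gibbsBand hinv hf.2⟩)
    ⟨⟨fun _ => zero_le_one, fun n ω γ _ _ => by
      simpa using mul_nonneg hD (pow_nonneg hθ0.le n)⟩, hone⟩
  have hbd := gibbsBand_bounds hc₁ hc₂ hone hband
  have hpos : ∀ ω, 0 < h ω := fun ω => (div_pos hc₁ hc₂).trans_le (hbd ω).1
  have hlogvar : ∀ (n : ℕ) (ω γ : MarkovShift S), 1 ≤ n → γ ∈ cyl ω n →
      Real.log (h ω) - Real.log (h γ) ≤ D * θ ^ n := fun n ω γ hn hγ => by
    have := Real.log_le_log (hpos ω) (hcone.2 n ω γ hn hγ)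
    rw [Real.log_mul (Real.exp_pos _).ne' (hpos γ).ne', Real.log_exp] at this
    linarith
  have hlogc : Continuous fun ω => Real.log (h ω) :=
    continuous_of_variation (by simpa using hpow.const_mul D) hlogvar
  have hψc : Continuous ψ :=
    continuous_of_variation (by simpa using hpow.const_mul C) fun n ω γ _ hγ => hψvar n ω γ hγ
  have hintc : ∀ {f : MarkovShift S → ℝ}, Continuous f → Integrable f μ := fun hf =>
    hf.integrable_of_hasCompactSupport (HasCompactSupport.of_compactSpace _)
  -- The coboundary has zero integral by invariance, and the fixed-point equation for `h` normalises
  -- `γ`.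
  let γ : MarkovShift S → ℝ := fun ω => ψ ω + (Real.log (h ω) - Real.log (h (shift S ω)))
  have hγc : Continuous γ := hψc.add (hlogc.sub (hlogc.comp continuous_shift))
  have hexpγ : ∀ ω, Real.exp (γ ω) = Real.exp (φ ω - P) * (h ω / h (shift S ω)) := fun ω => by
    simp only [γ, Real.exp_add, Real.exp_sub, Real.exp_log (hpos _), ψ]
  have hint : ∫ ω, γ ω ∂μ = ∫ ω, ψ ω ∂μ := by
    have h1 : ∫ ω, Real.log (h (shift S ω)) ∂μ = ∫ ω, Real.log (h ω) ∂μ :=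
      integral_comp_of_measurePreserving hinv (hintc hlogc)
    have h2 := integral_add (hintc hψc) ((hintc hlogc).sub (hintc (hlogc.comp continuous_shift)))
    have h3 := integral_sub (hintc hlogc) (hintc (hlogc.comp continuous_shift))
    simp only [Pi.sub_apply, Function.comp_apply] at h2 h3
    simp only [γ]
    rw [h2, h3, h1, sub_self, add_zero]
  have hdens := withDensity_exp_eq (ψ := ψ) (γ := γ) hinv
    (fun ω n => (mul_pos hc₁ (Real.exp_pos _)).trans_le (hgibbs' ω n).1) hc₂ (hintc hψc)
    hγc.measurable (hintc hγc) hint (fun ω n => (hgibbs' ω n).2)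
    -- The three terms bound the variations of `ψ`, `log h` and `log (h ∘ T)`; the last loses one
    -- letter to the shift.
    (ε := fun n => C * θ ^ (n + 1) + (D * θ ^ (n + 1) + D * θ ^ n))
    (by
      have h1 := (hpow.comp (Filter.tendsto_add_atTop_nat 1))
      simpa using (h1.const_mul C).add ((h1.const_mul D).add (hpow.const_mul D)))
    (fun n ω η hn hη => by
      have h1 := hψvar _ _ _ hη
      have h2 := hlogvar _ _ _ (by omega) hη
      have h3 := hlogvar _ _ _ hn (mem_cyl_comm.1 (shift_mem_cyl hη))
      simp only [γ]
      linarith)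
    (fun ω => by
      have h1 : ∀ a ∈ Finset.univ.filter fun a => S a (ω.1 0) = 1,
          Real.exp (γ (prepend S a ω)) =
            Real.exp (ψ (prepend S a ω)) * h (prepend S a ω) / h ω := fun a ha => by
        rw [hexpγ, shift_prepend (by simpa using ha), mul_div_assoc]
      rw [Finset.sum_congr rfl h1, ← Finset.sum_div, div_eq_one_iff_eq (hpos ω).ne']
      exact congrFun hfix ω)
  refine ⟨h, ?_, hpos, ?_⟩
  · simpa only [Function.comp_def, Real.exp_log (hpos _)] using Real.continuous_exp.comp hlogc
  · have hr := Measure.rnDeriv_withDensity (compShift μ) hγc.measurable.exp.ennreal_ofReal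
    rw [hdens] at hr
    filter_upwards [hr] with ω hω
    rw [inverseJacobian, hω, ENNReal.toReal_ofReal (Real.exp_nonneg _), hexpγ]

end Topology

end MarkovGibbs

theorem theorem3p5 {𝒜 : Type*} [Finite 𝒜] [Nontrivial 𝒜]
    [TopologicalSpace 𝒜] [DiscreteTopology 𝒜]
    [MeasurableSpace 𝒜] [MeasurableSingletonClass 𝒜]
    (S : Matrix 𝒜 𝒜 ℕ) (hS : MarkovGibbs.IsTransitionMatrix S)
    (hmix : MarkovGibbs.IsTopologicallyMixing (MarkovGibbs.shift S))
    (φ : MarkovGibbs.MarkovShift S → ℝ) (hφ : MarkovGibbs.IsHolder φ)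
    (P : ℝ) (μ : MeasureTheory.Measure (MarkovGibbs.MarkovShift S))
    (hμ : MarkovGibbs.IsGibbsMeasure φ P μ) :
    ∃ h : MarkovGibbs.MarkovShift S → ℝ, Continuous h ∧ (∀ ω, 0 < h ω) ∧
      ∀ᵐ ω ∂(MarkovGibbs.compShift μ),
        MarkovGibbs.inverseJacobian μ ω =
          Real.exp (φ ω - P) * (h ω / h (MarkovGibbs.shift S ω)) := by
  cases nonempty_fintype 𝒜
  exact hμ.exists_inverseJacobian_eq hφ
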